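/- Let $\mathbb{F}=\mathbb{R}$ or $\mathbb{C}$, let $n\ge 1$, and equip $\mathbb{F}^n$ with its standard inner product. A *linorder* is a relation $R\subseteq\mathbb{F}^n\times\mathbb{F}^n$ (finite or infinite) such that (1) if $(v,w)\in R$, $(\tilde v,\tilde w)\in R$ and $w\not\perp\tilde v$, then $(v,\tilde w)\in R$; and (2) if $(v,w)\in R$, then $v\perp w$. Let $\mathcal{V}_R=\operatorname{span}\{wv^*:(v,w)\in R\}\subseteq M_n(\mathbb{F})$. An *antichain* for $R$ is a linear subspace $C\subseteq\mathbb{F}^n$ such that every $(v,w)\in R$ satisfies $v\perp C$ or $w\perp C$ (or both). A *coherent decomposition of $\mathbb{F}^n$ into chains relative to $\mathcal{V}_R$* consists of a single matrix $A\in\mathcal{V}_R$ and finitely many sequences $(v_i,Av_i,\dots,A^{k_i-1}v_i)$, with $v_i\in\mathbb{F}^n$, $k_i\ge 1$ and $1\le i\le c$, whose elements taken together form a basis of $\mathbb{F}^n$; its *size* is the number $c$ of these sequences. Theorem (Coherent linear Dilworth's theorem). Let $n\ge 1$ and let $R\subseteq\mathbb{F}^n\times\mathbb{F}^n$ be a linorder.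 Then the minimum size of a coherent decomposition of $\mathbb{F}^n$ into chains relative to $\mathcal{V}_R$ equals the maximum dimension of an antichain for $R$. -/

import Mathlib

/-- `R ⊆ 𝔽ⁿ × 𝔽ⁿ` is a linorder: it is transitive in the sense that `(v, w), (v', w') ∈ R` and
`w` not orthogonal to `v'` imply `(v, w') ∈ R`, and `(v, w) ∈ R` implies `v ⊥ w`. -/
structure IsLinorder {𝕜 : Type*} [RCLike 𝕜] {n : ℕ}
    (R : Set (EuclideanSpace 𝕜 (Fin n) × EuclideanSpace 𝕜 (Fin n))) : Prop where
  trans : ∀ v w v' w' : EuclideanSpace 𝕜 (Fin n),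
    (v, w) ∈ R → (v', w') ∈ R → inner 𝕜 w v' ≠ 0 → (v, w') ∈ R
  orthogonal : ∀ v w : EuclideanSpace 𝕜 (Fin n), (v, w) ∈ R → inner 𝕜 v w = 0

/-- The rank (at most) one matrix `w v*`, with `(i, j)` entry `wᵢ` times the conjugate of `vⱼ`. -/
def rankOneMatrix {𝕜 : Type*} [RCLike 𝕜] {n : ℕ} (w v : EuclideanSpace 𝕜 (Fin n)) :
    Matrix (Fin n) (Fin n) 𝕜 :=
  Matrix.of fun i j => w i * star (v j)

/-- The linear span `𝒱_R` of the matrices `w v*` with `(v, w) ∈ R`. -/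
def matrixSpan {𝕜 : Type*} [RCLike 𝕜] {n : ℕ}
    (R : Set (EuclideanSpace 𝕜 (Fin n) × EuclideanSpace 𝕜 (Fin n))) :
    Submodule 𝕜 (Matrix (Fin n) (Fin n) 𝕜) :=
  Submodule.span 𝕜 {M | ∃ v w, (v, w) ∈ R ∧ M = rankOneMatrix w v}

/-- A subspace `C` is an antichain for `R` if every `(v, w) ∈ R` has `v ⊥ C` or `w ⊥ C`. -/
def IsAntichainFor {𝕜 : Type*} [RCLike 𝕜] {n : ℕ}
    (R : Set (EuclideanSpace 𝕜 (Fin n) × EuclideanSpace 𝕜 (Fin n)))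
    (C : Submodule 𝕜 (EuclideanSpace 𝕜 (Fin n))) : Prop :=
  ∀ v w : EuclideanSpace 𝕜 (Fin n), (v, w) ∈ R → v ∈ Cᗮ ∨ w ∈ Cᗮ

/-- The sequence `(v, A v, …, A ^ (k - 1) v)`. -/
def coherentChain {𝕜 : Type*} [RCLike 𝕜] {n : ℕ} (A : Matrix (Fin n) (Fin n) 𝕜)
    (v : EuclideanSpace 𝕜 (Fin n)) (k : ℕ) : Fin k → EuclideanSpace 𝕜 (Fin n) :=
  fun j => WithLp.toLp 2 ((A ^ (j : ℕ)).mulVec v.ofLp)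

/-- A coherent decomposition of `𝔽ⁿ`, relative to the space of matrices `𝒱`, into `c` chains:
nonempty chains `(vᵢ, A vᵢ, …, A ^ (kᵢ - 1) vᵢ)`, `i < c`, all implemented by a single `A ∈ 𝒱`,
whose elements collectively form a basis of `𝔽ⁿ`. -/
structure CoherentDecomposition {𝕜 : Type*} [RCLike 𝕜] {n : ℕ}
    (𝒱 : Submodule 𝕜 (Matrix (Fin n) (Fin n) 𝕜)) (c : ℕ) where
  /-- the implementing matrix -/
  A : Matrix (Fin n) (Fin n) 𝕜
  A_mem : A ∈ 𝒱
  /-- the first vector of each chain -/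
  head : Fin c → EuclideanSpace 𝕜 (Fin n)
  /-- the number of elements of each chain -/
  len : Fin c → ℕ
  len_pos : ∀ i, 1 ≤ len i
  linearIndependent : LinearIndependent 𝕜
    (fun p : (i : Fin c) × Fin (len i) => coherentChain A (head p.1) (len p.1) p.2)
  span_eq_top : Submodule.span 𝕜 (Set.range
    (fun p : (i : Fin c) × Fin (len i) => coherentChain A (head p.1) (len p.1) p.2)) = ⊤

/-!
Write `𝒱` for `matrixSpan R`. The common value of the minimum and the maximum is the least
dimension of `ker A` for `A ∈ 𝒱`.

Transitivity of `R` makes `𝒱` an algebra (without unit), and orthogonality makes every matrix in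
it traceless. So all positive powers of `A ∈ 𝒱` are traceless, and `A` is nilpotent
(`LinearMap.isNilpotent_of_trace_pow_eq_zero`). Its Jordan form
(`exists_chain_basis_of_isNilpotent`) is a coherent decomposition into `dim ker A` chains, and no
decomposition implemented by `A` has fewer chains, since the heads span `𝔽ⁿ` modulo `range A`.

If `C` is an antichain and `A ∈ 𝒱`, then `A ^ k C ⊥ C` for all `k ≥ 1`, as `A ^ k ∈ 𝒱`; counting
dimensions in `C + A C + A ^ 2 C + ⋯` gives `dim C ≤ dim ker A`
(`finrank_le_finrank_ker_of_inner_pow_eq_zero`). So every antichain is at most as large as every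
decomposition.

Equality is attained because `𝒱` is spanned by rank one matrices `wᵢ vᵢ*`: by the matroid
intersection theorem (`exists_common_independent`) for the linear matroids of the `vᵢ` and of
the `wᵢ`, there are `A ∈ 𝒱` and an antichain `C` with `dim ker A ≤ dim C`
(`exists_finrank_ker_le_finrank_antichain`).
-/

/-! ### Matroid intersection -/

/-- The matroid intersection theorem with a contracted set `F`: two submodular functions of unit
increase have a common independent set of size `k` modulo `F` as soon as every partition of the
ground set into two parts has ranks modulo `F` adding up to at least `k`. The contracted set is
what the induction on the ground set `E` needs; the case of interest is `F = ∅`. -/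
theorem exists_common_independent {ι : Type*} [DecidableEq ι] (r₁ r₂ : Finset ι → ℕ)
    (sub₁ : ∀ S T, r₁ (S ∪ T) + r₁ (S ∩ T) ≤ r₁ S + r₁ T)
    (sub₂ : ∀ S T, r₂ (S ∪ T) + r₂ (S ∩ T) ≤ r₂ S + r₂ T)
    (unit₁ : ∀ S e, r₁ (insert e S) ≤ r₁ S + 1)
    (unit₂ : ∀ S e, r₂ (insert e S) ≤ r₂ S + 1)
    (E : Finset ι) : ∀ (F : Finset ι) (k : ℕ),
      (∀ S ⊆ E, k + r₁ F + r₂ F ≤ r₁ (F ∪ S) + r₂ (F ∪ (E \ S))) →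
      ∃ J ⊆ E, J.card = k ∧ r₁ (F ∪ J) = r₁ F + k ∧ r₂ (F ∪ J) = r₂ F + k := by
  induction E using Finset.induction_on with
  | empty =>
    intro F k h
    have := h ∅ (by simp)
    simp only [Finset.sdiff_self, Finset.union_empty] at this
    exact ⟨∅, by simp, by simp; omega, by simp; omega, by simp; omega⟩
  | insert e E he ih =>
    intro F k h
    rcases Nat.eq_zero_or_pos k with rfl | hk
    · exact ⟨∅, by simp, by simp, by simp, by simp⟩
    by_cases hA : ∀ S ⊆ E, k + r₁ F + r₂ F ≤ r₁ (F ∪ S) + r₂ (F ∪ (E \ S))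
    · obtain ⟨J, hJ, h'⟩ := ih F k hA
      exact ⟨J, hJ.trans (Finset.subset_insert _ _), h'⟩
    push Not at hA
    obtain ⟨S, hS, hSlt⟩ := hA
    have heS : e ∉ S := fun h => he (hS h)
    -- Deleting `e` makes the bound fail at `S`. Should contracting `e` make it fail at some `T`,
    -- uncrossing the two partitions would break `h` at `S ∩ T` or at `insert e (S ∪ T)`.
    have key : ∀ T ⊆ E, (k - 1) + r₁ F + r₂ F + 2 ≤
        r₁ (insert e F ∪ T) + r₂ (insert e F ∪ (E \ T)) := by
      intro T hT
      have heT : e ∉ T := fun h => he (hT h)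
      have h1 := h (S ∩ T) ((Finset.inter_subset_left.trans hS).trans (Finset.subset_insert _ _))
      have h2 := h (insert e (S ∪ T)) (Finset.insert_subset_insert _ (Finset.union_subset hS hT))
      have s1 := sub₁ (F ∪ S) (insert e F ∪ T)
      have s2 := sub₂ (F ∪ (E \ S)) (insert e F ∪ (E \ T))
      have e1 : F ∪ S ∪ (insert e F ∪ T) = F ∪ insert e (S ∪ T) := by grind
      have e2 : (F ∪ S) ∩ (insert e F ∪ T) = F ∪ (S ∩ T) := by grind
      have e3 : F ∪ (E \ S) ∪ (insert e F ∪ (E \ T)) = F ∪ (insert e E \ (S ∩ T)) := by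
        grind
      have e4 : (F ∪ (E \ S)) ∩ (insert e F ∪ (E \ T))
          = F ∪ (insert e E \ insert e (S ∪ T)) := by grind
      rw [e1, e2] at s1
      rw [e3, e4] at s2
      omega
    -- `e` is a loop for neither function, since the bound fails after its deletion.
    have hn₁ : r₁ (insert e F) = r₁ F + 1 := by
      have h1 := h (insert e S) (Finset.insert_subset_insert _ hS)
      have s1 := sub₁ (F ∪ S) (insert e F)
      have e1 : F ∪ S ∪ insert e F = F ∪ insert e S := by grind
      have e2 : (F ∪ S) ∩ insert e F = F := by grind
      have e3 : insert e E \ insert e S = E \ S := by grind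
      rw [e1, e2] at s1
      rw [e3] at h1
      have := unit₁ F e
      omega
    have hn₂ : r₂ (insert e F) = r₂ F + 1 := by
      have h1 := h S (hS.trans (Finset.subset_insert _ _))
      have s2 := sub₂ (F ∪ (E \ S)) (insert e F)
      have e1 : F ∪ (E \ S) ∪ insert e F = F ∪ (insert e E \ S) := by grind
      have e2 : (F ∪ (E \ S)) ∩ insert e F = F := by grind
      rw [e1, e2] at s2
      have := unit₂ F e
      omega
    obtain ⟨J, hJ, hJc, hJ₁, hJ₂⟩ := ih (insert e F) (k - 1) fun T hT => by
      have := key T hT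
      omega
    refine ⟨insert e J, Finset.insert_subset_insert _ hJ, ?_, ?_, ?_⟩
    · rw [Finset.card_insert_of_notMem fun h => he (hJ h)]
      omega
    · rw [Finset.union_insert, ← Finset.insert_union]
      omega
    · rw [Finset.union_insert, ← Finset.insert_union]
      omega

theorem finrank_span_image_union_add_inter_le {K V ι : Type*} [Field K] [AddCommGroup V]
    [Module K V] [FiniteDimensional K V] [DecidableEq ι] (v : ι → V) (S T : Finset ι) :
    Module.finrank K (Submodule.span K (v '' (S ∪ T : Finset ι))) +
        Module.finrank K (Submodule.span K (v '' (S ∩ T : Finset ι))) ≤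
      Module.finrank K (Submodule.span K (v '' S)) +
        Module.finrank K (Submodule.span K (v '' T)) := by
  rw [Finset.coe_union, Finset.coe_inter, Set.image_union, Submodule.span_union,
    ← Submodule.finrank_sup_add_finrank_inf_eq (Submodule.span K (v '' S))]
  exact Nat.add_le_add_left (Submodule.finrank_mono (le_inf
    (Submodule.span_mono (Set.image_mono Set.inter_subset_left))
    (Submodule.span_mono (Set.image_mono Set.inter_subset_right)))) _

theorem finrank_span_image_insert_le {K V ι : Type*} [Field K] [AddCommGroup V]
    [Module K V] [FiniteDimensional K V] [DecidableEq ι] (v : ι → V) (S : Finset ι) (e : ι) :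
    Module.finrank K (Submodule.span K (v '' (insert e S : Finset ι))) ≤
      Module.finrank K (Submodule.span K (v '' S)) + 1 := by
  rw [Finset.coe_insert, Set.image_insert_eq, Submodule.span_insert, sup_comm]
  exact (Submodule.finrank_add_le_finrank_add_finrank _ _).trans
    (Nat.add_le_add_left ((finrank_span_le_card {v e}).trans (by simp)) _)

/-! ### Nilpotent endomorphisms -/

/-- If `T` were not nilpotent, some polynomial in `T` without constant term would be a nonzero
idempotent `e`, and `e` would have nonzero trace in characteristic zero. -/
theorem LinearMap.isNilpotent_of_trace_pow_eq_zero {K V : Type*} [Field K] [CharZero K]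
    [AddCommGroup V] [Module K V] [FiniteDimensional K V] (T : Module.End K V)
    (h : ∀ k, 1 ≤ k → LinearMap.trace K V (T ^ k) = 0) : IsNilpotent T := by
  have hp : minpoly K T ≠ 0 := minpoly.ne_zero (Algebra.IsIntegral.isIntegral T)
  -- The minimal polynomial is `X ^ m * q` with `q` prime to `X`.
  obtain ⟨q, hq, hq0⟩ := Polynomial.exists_eq_pow_rootMultiplicity_mul_and_not_dvd _ hp 0
  set m := (minpoly K T).rootMultiplicity 0
  rw [Polynomial.C_0, sub_zero] at hq hq0
  have hcop : IsCoprime (Polynomial.X ^ (m + 1)) q :=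
    IsCoprime.pow_left ((Polynomial.irreducible_X.coprime_iff_not_dvd).2 hq0)
  obtain ⟨a, b, hab⟩ := hcop
  have hzero : Polynomial.aeval T (Polynomial.X ^ (m + 1) * q) = 0 := by
    rw [pow_succ', mul_assoc, ← hq, map_mul, minpoly.aeval, mul_zero]
  set e := Polynomial.aeval T (a * Polynomial.X ^ (m + 1)) with he
  have hidem : IsIdempotentElem e := by
    have : a * Polynomial.X ^ (m + 1) * (a * Polynomial.X ^ (m + 1)) =
        a * Polynomial.X ^ (m + 1) - a * b * (Polynomial.X ^ (m + 1) * q) := by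
      linear_combination (a * Polynomial.X ^ (m + 1)) * hab
    rw [IsIdempotentElem, he, ← map_mul, this, map_sub, map_mul _ (a * b), hzero, mul_zero, sub_zero]
  have htr : LinearMap.trace K V e = 0 := by
    rw [he, map_mul, Polynomial.aeval_eq_sum_range, Finset.sum_mul, map_sum]
    refine Finset.sum_eq_zero fun i _ => ?_
    rw [map_pow, Polynomial.aeval_X, smul_mul_assoc, ← pow_add, map_smul, h _ (by omega), smul_zero]
  have he0 : e = 0 := LinearMap.IsIdempotentElem.eq_zero_of_trace_eq_zero hidem htr
  refine ⟨m + 1, ?_⟩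
  have : (Polynomial.X : Polynomial K) ^ (m + 1) =
      Polynomial.X ^ (m + 1) * (a * Polynomial.X ^ (m + 1))
      + b * (Polynomial.X ^ (m + 1) * q) := by
    linear_combination - (Polynomial.X : Polynomial K) ^ (m + 1) * hab
  have := congrArg (Polynomial.aeval T) this
  rwa [map_add, map_mul, ← he, he0, mul_zero, map_mul, hzero, mul_zero, add_zero, map_pow,
    Polynomial.aeval_X] at this

/-- The Jordan form of a nilpotent endomorphism `T`: chains `(x, T x, …, T ^ (k - 1) x)` with
`T ^ k x = 0`, as many as `dim ker T`, that together form a basis. By induction on the dimension: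
the chains of the restriction of `T` to `range T` are prolonged by a preimage of their heads, and
a basis of a complement in `ker T` of the span of their last vectors is added. -/
theorem exists_chain_basis_of_isNilpotent {K : Type*} [Field K] (n : ℕ) : ∀ {V : Type*}
    [AddCommGroup V] [Module K V] [FiniteDimensional K V] (T : Module.End K V)
    (_ : IsNilpotent T) (_ : Module.finrank K V = n),
    ∃ (ι : Type) (_ : Fintype ι) (head : ι → V) (len : ι → ℕ),
      Fintype.card ι = Module.finrank K (LinearMap.ker T) ∧
      (∀ i, 1 ≤ len i ∧ (T ^ len i) (head i) = 0) ∧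
      LinearIndependent K (fun p : (i : ι) × Fin (len i) => (T ^ (p.2 : ℕ)) (head p.1)) ∧
      Submodule.span K
        (Set.range fun p : (i : ι) × Fin (len i) => (T ^ (p.2 : ℕ)) (head p.1)) = ⊤ := by
  induction n using Nat.strong_induction_on with
  | _ n ih =>
  intro V _ _ _ T hT hn
  rcases Nat.eq_zero_or_pos n with rfl | hpos
  · have : Subsingleton V := Module.finrank_zero_iff.1 hn
    refine ⟨Empty, inferInstance, nofun, nofun, ?_, nofun, ?_, Subsingleton.elim _ _⟩
    · simp [Module.finrank_zero_of_subsingleton]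
    · exact linearIndependent_empty_type
  have hlt : Module.finrank K (LinearMap.range T) < n := by
    rw [← hn]
    refine Submodule.finrank_lt fun htop => ?_
    obtain ⟨N, hN⟩ := hT
    have hsurj : Function.Surjective (T ^ N) := by
      rw [Module.End.coe_pow]
      exact (LinearMap.range_eq_top.1 htop).iterate N
    have : Nontrivial V := Module.nontrivial_of_finrank_pos (R := K) (by omega)
    obtain ⟨x, hx⟩ := exists_ne (0 : V)
    obtain ⟨y, hy⟩ := hsurj x
    rw [hN] at hy
    exact hx hy.symm
  let T' : Module.End K (LinearMap.range T) := T.restrict fun x _ => LinearMap.mem_range_self T x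
  have hT'pow : ∀ (j : ℕ) (w : LinearMap.range T), ((T' ^ j) w : V) = (T ^ j) w := by
    intro j
    induction j with
    | zero => intro w; rfl
    | succ j ihj =>
      intro w
      rw [pow_succ, pow_succ, Module.End.mul_apply, Module.End.mul_apply, ihj]
      rfl
  have hT' : IsNilpotent T' := by
    obtain ⟨N, hN⟩ := hT
    refine ⟨N, LinearMap.ext fun w => Subtype.ext ?_⟩
    rw [hT'pow, hN]; rfl
  obtain ⟨ι, _, w, m, -, hm, hli, hspan⟩ := ih _ hlt T' hT' rfl
  choose v hv using fun i => (w i).2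
  have hmem : ∀ i, (T ^ m i) (v i) ∈ LinearMap.ker T := fun i => by
    rw [LinearMap.mem_ker, ← Module.End.mul_apply, ← pow_succ', pow_succ, Module.End.mul_apply, hv,
      ← hT'pow, (hm i).2]
    rfl
  let z : ι → LinearMap.ker T := fun i => ⟨(T ^ m i) (v i), hmem i⟩
  have hz : LinearIndependent K z := by
    have h1 := hli.comp (fun i => (⟨i, ⟨m i - 1, by have := (hm i).1; omega⟩⟩ :
      (i : ι) × Fin (m i))) (fun i j hij => congrArg Sigma.fst hij)
    refine LinearIndependent.of_comp (LinearMap.ker T).subtype ?_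
    have heq : (LinearMap.ker T).subtype ∘ z = (LinearMap.range T).subtype ∘
        ((fun p : (i : ι) × Fin (m i) => (T' ^ (p.2 : ℕ)) (w p.1)) ∘ fun i =>
          (⟨i, ⟨m i - 1, by have := (hm i).1; omega⟩⟩ : (i : ι) × Fin (m i))) := by
      funext i
      simp only [Function.comp_apply, Submodule.subtype_apply, hT'pow, ← hv, z]
      rw [← Module.End.mul_apply, ← pow_succ, Nat.sub_add_cancel (hm i).1]
    rw [heq]
    exact h1.map' (LinearMap.range T).subtype (Submodule.ker_subtype _)
  obtain ⟨Q, hQ⟩ := Submodule.exists_isCompl (Submodule.span K (Set.range z))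
  let u := Module.finBasis K Q
  have hcard : Fintype.card ι + Module.finrank K Q = Module.finrank K (LinearMap.ker T) := by
    rw [← finrank_span_eq_card hz, Submodule.finrank_add_eq_of_isCompl hQ]
  let head : ι ⊕ Fin (Module.finrank K Q) → V := Sum.elim v fun l => ((u l : LinearMap.ker T) : V)
  let len : ι ⊕ Fin (Module.finrank K Q) → ℕ := Sum.elim (fun i => m i + 1) fun _ => 1
  have htop : Submodule.span K (Set.range fun p : (i : ι ⊕ Fin (Module.finrank K Q)) × Fin (len i) =>
      (T ^ (p.2 : ℕ)) (head p.1)) = ⊤ := by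
    set S := Submodule.span K (Set.range fun p : (i : ι ⊕ Fin (Module.finrank K Q)) × Fin (len i) =>
      (T ^ (p.2 : ℕ)) (head p.1)) with hS
    have hmemS : ∀ i j, j < len i → (T ^ j) (head i) ∈ S := fun i j hj =>
      Submodule.subset_span ⟨⟨i, ⟨j, hj⟩⟩, rfl⟩
    have hker : LinearMap.ker T ≤ S := by
      rw [← Submodule.comap_subtype_eq_top, eq_top_iff, ← hQ.sup_eq_top, sup_le_iff]
      constructor
      · rw [Submodule.span_le]
        rintro _ ⟨i, rfl⟩
        exact hmemS (Sum.inl i) (m i) (Nat.lt_succ_self _)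
      · have : Q = Submodule.map Q.subtype ⊤ := by simp
        rw [this, ← u.span_eq, Submodule.map_span, Submodule.span_le]
        rintro _ ⟨_, ⟨l, rfl⟩, rfl⟩
        exact hmemS (Sum.inr l) 0 (Nat.zero_lt_one)
    have hrange : LinearMap.range T ≤ S.map T := by
      have : LinearMap.range T = Submodule.map (LinearMap.range T).subtype ⊤ := by simp
      rw [this, ← hspan, Submodule.map_span, Submodule.span_le]
      rintro _ ⟨_, ⟨⟨i, j⟩, rfl⟩, rfl⟩
      refine ⟨(T ^ (j : ℕ)) (v i), hmemS (Sum.inl i) j (j.2.trans (Nat.lt_succ_self _)), ?_⟩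
      rw [Submodule.subtype_apply, hT'pow, ← hv, ← Module.End.mul_apply, ← Module.End.mul_apply,
        ← pow_succ', ← pow_succ]
    rw [eq_top_iff]
    intro x _
    obtain ⟨y, hy, hyx⟩ := hrange (LinearMap.mem_range_self T x)
    have : x - y ∈ S := hker (by rw [LinearMap.mem_ker, map_sub, hyx, sub_self])
    simpa using S.add_mem this hy
  refine ⟨_, inferInstance, head, len, by simp [hcard], ?_, ?_, htop⟩
  · rintro (i | l)
    · refine ⟨Nat.le_add_left _ _, ?_⟩
      have := hmem i
      rw [LinearMap.mem_ker, ← Module.End.mul_apply, ← pow_succ'] at this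
      exact this
    · exact ⟨le_rfl, by simp [len, head]⟩
  -- The spanning family has `dim range T + dim ker T` elements, hence is a basis.
  · refine linearIndependent_of_top_le_span_of_card_eq_finrank htop.ge ?_
    have h1 := Module.finrank_eq_card_basis (Module.Basis.mk hli hspan.ge)
    have h2 := LinearMap.finrank_range_add_finrank_ker T
    simp only [Fintype.card_sigma, Fintype.card_fin] at h1
    simp only [Fintype.card_sigma, Fintype.card_fin, Fintype.sum_sum_type, len, Sum.elim_inl,
      Sum.elim_inr, Finset.sum_add_distrib, Finset.sum_const, Finset.card_univ, smul_eq_mul,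
      mul_one]
    omega

/-! ### Subspaces orthogonal to their iterated images -/

/-- If `T ^ k C ⊥ C` for all `k ≥ 1`, let `D` be the sum of these images `T ^ k C`. Then `T` maps
`C ⊔ D` into `D`, and `D` has codimension `dim C` in `C ⊔ D`, so `ker T` has at least that
dimension. -/
theorem finrank_le_finrank_ker_of_inner_pow_eq_zero {𝕜 E : Type*} [RCLike 𝕜]
    [NormedAddCommGroup E] [InnerProductSpace 𝕜 E] [FiniteDimensional 𝕜 E] (T : Module.End 𝕜 E)
    (C : Submodule 𝕜 E)
    (h : ∀ k, 1 ≤ k → ∀ x ∈ C, ∀ y ∈ C, inner 𝕜 y ((T ^ k) x) = 0) :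
    Module.finrank 𝕜 C ≤ Module.finrank 𝕜 (LinearMap.ker T) := by
  set D : Submodule 𝕜 E := ⨆ k : ℕ, C.map (T ^ (k + 1)) with hD
  have hDC : D ≤ Cᗮ := by
    refine iSup_le fun k => ?_
    rintro _ ⟨x, hx, rfl⟩
    exact (Submodule.mem_orthogonal _ _).2 fun y hy => h _ (Nat.le_add_left _ _) x hx y hy
  have hdisj : C ⊓ D = ⊥ := (C.orthogonal_disjoint.mono_right hDC).eq_bot
  have hmap : (C ⊔ D).map T ≤ D := by
    rw [Submodule.map_sup, hD, Submodule.map_iSup]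
    refine sup_le ?_ (iSup_le fun k => ?_)
    · have := le_iSup (fun k : ℕ => C.map (T ^ (k + 1))) 0
      simpa using this
    · rw [← Submodule.map_comp, ← Module.End.mul_eq_comp, ← pow_succ']
      exact le_iSup (fun k : ℕ => C.map (T ^ (k + 1))) (k + 1)
  have h1 := Submodule.finrank_sup_add_finrank_inf_eq C D
  rw [hdisj, finrank_bot] at h1
  have h2 := LinearMap.finrank_range_add_finrank_ker (T.domRestrict (C ⊔ D))
  rw [LinearMap.range_domRestrict] at h2
  have h3 := Submodule.finrank_mono hmap
  have h4 : Module.finrank 𝕜 (LinearMap.ker (T.domRestrict (C ⊔ D))) ≤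
      Module.finrank 𝕜 (LinearMap.ker T) := by
    rw [LinearMap.ker_domRestrict]
    exact LinearMap.finrank_le_finrank_of_injective
      (f := ((C ⊔ D).subtype.restrict fun x hx => hx :
        (LinearMap.ker T).submoduleOf (C ⊔ D) →ₗ[𝕜] LinearMap.ker T))
      fun x y hxy => Subtype.ext (Subtype.ext (by have := congrArg Subtype.val hxy; exact this))
  omega

/-! ### The algebra spanned by a linorder -/

section

variable {𝕜 : Type*} [RCLike 𝕜] {n : ℕ}
  {R : Set (EuclideanSpace 𝕜 (Fin n) × EuclideanSpace 𝕜 (Fin n))}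

theorem toEuclideanLin_rankOneMatrix (w v x : EuclideanSpace 𝕜 (Fin n)) :
    Matrix.toEuclideanLin (rankOneMatrix w v) x = inner 𝕜 v x • w := by
  ext i
  simp only [Matrix.ofLp_toLpLin, Matrix.toLin'_apply, Matrix.mulVec, dotProduct, rankOneMatrix,
    Matrix.of_apply, PiLp.smul_apply, smul_eq_mul, PiLp.inner_apply, RCLike.inner_apply,
    Finset.sum_mul]
  exact Finset.sum_congr rfl fun j _ => by rw [starRingEnd_apply]; ring

theorem toEuclideanLin_pow (A : Matrix (Fin n) (Fin n) 𝕜) (k : ℕ) :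
    Matrix.toEuclideanLin (A ^ k) = (Matrix.toEuclideanLin A) ^ k :=
  Matrix.toLpLin_pow ..

theorem coherentChain_apply (A : Matrix (Fin n) (Fin n) 𝕜) (v : EuclideanSpace 𝕜 (Fin n)) (k : ℕ)
    (j : Fin k) : coherentChain A v k j = (Matrix.toEuclideanLin A ^ (j : ℕ)) v := by
  rw [← toEuclideanLin_pow]
  rfl

theorem rankOneMatrix_mul (w v w' v' : EuclideanSpace 𝕜 (Fin n)) :
    rankOneMatrix w v * rankOneMatrix w' v' = inner 𝕜 v w' • rankOneMatrix w v' := by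
  ext i j
  simp only [Matrix.mul_apply, rankOneMatrix, Matrix.of_apply, Matrix.smul_apply, smul_eq_mul,
    PiLp.inner_apply, RCLike.inner_apply, Finset.sum_mul]
  exact Finset.sum_congr rfl fun j _ => by rw [starRingEnd_apply]; ring

theorem trace_rankOneMatrix (w v : EuclideanSpace 𝕜 (Fin n)) :
    (rankOneMatrix w v).trace = inner 𝕜 v w := by
  simp [Matrix.trace, rankOneMatrix, PiLp.inner_apply, RCLike.inner_apply]

theorem matrixSpan_induction {p : Matrix (Fin n) (Fin n) 𝕜 → Prop}
    (rankOne : ∀ v w, (v, w) ∈ R → p (rankOneMatrix w v)) (zero : p 0)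
    (add : ∀ A B, p A → p B → p (A + B)) (smul : ∀ (a : 𝕜) A, p A → p (a • A))
    {A : Matrix (Fin n) (Fin n) 𝕜} (hA : A ∈ matrixSpan R) : p A := by
  induction hA using Submodule.span_induction with
  | mem A h => obtain ⟨v, w, hvw, rfl⟩ := h; exact rankOne v w hvw
  | zero => exact zero
  | add A B _ _ h₁ h₂ => exact add A B h₁ h₂
  | smul a A _ h => exact smul a A h

theorem rankOneMatrix_mem_matrixSpan {v w : EuclideanSpace 𝕜 (Fin n)} (h : (v, w) ∈ R) :
    rankOneMatrix w v ∈ matrixSpan R :=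
  Submodule.subset_span ⟨v, w, h, rfl⟩

/-- Transitivity of a linorder makes `𝒱_R` closed under multiplication. -/
theorem IsLinorder.mul_mem_matrixSpan (hR : IsLinorder R) {A B : Matrix (Fin n) (Fin n) 𝕜}
    (hA : A ∈ matrixSpan R) (hB : B ∈ matrixSpan R) : A * B ∈ matrixSpan R := by
  refine matrixSpan_induction (p := fun A => A * B ∈ matrixSpan R) (fun v w hvw => ?_) ?_ ?_ ?_ hA
  · refine matrixSpan_induction (p := fun B => rankOneMatrix w v * B ∈ matrixSpan R)
      (fun v' w' hvw' => ?_) ?_ ?_ ?_ hB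
    · rw [rankOneMatrix_mul]
      by_cases h0 : inner 𝕜 w' v = 0
      · rw [inner_eq_zero_symm.1 h0, zero_smul]
        exact zero_mem _
      · exact Submodule.smul_mem _ _ (rankOneMatrix_mem_matrixSpan (hR.trans _ _ _ _ hvw' hvw h0))
    · simp
    · intro A B h₁ h₂
      rw [mul_add]
      exact add_mem h₁ h₂
    · intro a A h
      rw [mul_smul_comm]
      exact Submodule.smul_mem _ _ h
  · simp
  · intro A B h₁ h₂
    rw [add_mul]
    exact add_mem h₁ h₂
  · intro a A h
    rw [smul_mul_assoc]
    exact Submodule.smul_mem _ _ h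

theorem IsLinorder.pow_mem_matrixSpan (hR : IsLinorder R) {A : Matrix (Fin n) (Fin n) 𝕜}
    (hA : A ∈ matrixSpan R) {k : ℕ} (hk : 1 ≤ k) : A ^ k ∈ matrixSpan R := by
  induction k, hk using Nat.le_induction with
  | base => rwa [pow_one]
  | succ k _ ih =>
    rw [pow_succ]
    exact hR.mul_mem_matrixSpan ih hA

theorem IsLinorder.trace_eq_zero (hR : IsLinorder R) {A : Matrix (Fin n) (Fin n) 𝕜}
    (hA : A ∈ matrixSpan R) : A.trace = 0 := by
  refine matrixSpan_induction (p := fun A => A.trace = 0) (fun v w hvw => ?_) ?_ ?_ ?_ hA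
  · rw [trace_rankOneMatrix, hR.orthogonal v w hvw]
  · simp
  · intro A B h₁ h₂
    rw [Matrix.trace_add, h₁, h₂, add_zero]
  · intro a A h
    rw [Matrix.trace_smul, h, smul_zero]

theorem IsLinorder.isNilpotent_toEuclideanLin (hR : IsLinorder R) {A : Matrix (Fin n) (Fin n) 𝕜}
    (hA : A ∈ matrixSpan R) : IsNilpotent (Matrix.toEuclideanLin A : Module.End 𝕜 _) := by
  refine LinearMap.isNilpotent_of_trace_pow_eq_zero _ fun k hk => ?_
  rw [← toEuclideanLin_pow, LinearEquiv.congr_fun (Matrix.toLpLin_eq_toLin 2 2) (A ^ k),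
    Matrix.trace_toLin_eq]
  exact hR.trace_eq_zero (hR.pow_mem_matrixSpan hA hk)

/-- That `C` is an antichain depends on `R` only through `𝒱_R`: it says that `P A P = 0` for all
`A ∈ 𝒱_R`, where `P` is the projection onto `C`. -/
theorem isAntichainFor_iff_forall_mem_matrixSpan {C : Submodule 𝕜 (EuclideanSpace 𝕜 (Fin n))} :
    IsAntichainFor R C ↔ ∀ A ∈ matrixSpan R, ∀ x ∈ C, ∀ y ∈ C,
      inner 𝕜 y (Matrix.toEuclideanLin A x) = 0 := by
  constructor
  · intro hC A hA x hx y hy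
    refine matrixSpan_induction
      (p := fun A => inner 𝕜 y (Matrix.toEuclideanLin A x) = 0) (fun v w hvw => ?_) ?_ ?_ ?_ hA
    · rw [toEuclideanLin_rankOneMatrix, inner_smul_right]
      rcases hC v w hvw with h | h
      · rw [(Submodule.mem_orthogonal' _ _).1 h x hx, zero_mul]
      · rw [(Submodule.mem_orthogonal _ _).1 h y hy, mul_zero]
    · simp
    · intro A B h₁ h₂
      rw [map_add, LinearMap.add_apply, inner_add_right, h₁, h₂, add_zero]
    · intro a A h
      rw [map_smul, LinearMap.smul_apply, inner_smul_right, h, mul_zero]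
  · intro h v w hvw
    by_contra! hcon
    obtain ⟨h₁, h₂⟩ := hcon
    rw [Submodule.mem_orthogonal'] at h₁
    rw [Submodule.mem_orthogonal] at h₂
    push Not at h₁ h₂
    obtain ⟨x, hx, hvx⟩ := h₁
    obtain ⟨y, hy, hyw⟩ := h₂
    have := h _ (rankOneMatrix_mem_matrixSpan hvw) x hx y hy
    rw [toEuclideanLin_rankOneMatrix, inner_smul_right] at this
    exact mul_ne_zero hvx hyw this

/-! ### Antichains, decompositions and kernels -/

theorem IsLinorder.finrank_antichain_le_finrank_ker (hR : IsLinorder R)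
    {C : Submodule 𝕜 (EuclideanSpace 𝕜 (Fin n))} (hC : IsAntichainFor R C)
    {A : Matrix (Fin n) (Fin n) 𝕜} (hA : A ∈ matrixSpan R) :
    Module.finrank 𝕜 C ≤ Module.finrank 𝕜 (LinearMap.ker (Matrix.toEuclideanLin A)) := by
  refine finrank_le_finrank_ker_of_inner_pow_eq_zero _ C fun k hk x hx y hy => ?_
  rw [← toEuclideanLin_pow]
  exact isAntichainFor_iff_forall_mem_matrixSpan.1 hC _ (hR.pow_mem_matrixSpan hA hk) x hx y hy

/-- The heads of the chains span the whole space modulo the range of the implementing matrix, so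
there are at least as many chains as the dimension of its kernel. -/
theorem CoherentDecomposition.finrank_ker_le {𝒱 : Submodule 𝕜 (Matrix (Fin n) (Fin n) 𝕜)} {c : ℕ}
    (D : CoherentDecomposition 𝒱 c) :
    Module.finrank 𝕜 (LinearMap.ker (Matrix.toEuclideanLin D.A)) ≤ c := by
  have htop : Submodule.span 𝕜 (Set.range D.head) ⊔ LinearMap.range (Matrix.toEuclideanLin D.A)
      = ⊤ := by
    rw [eq_top_iff, ← D.span_eq_top, Submodule.span_le]
    rintro _ ⟨⟨i, j, hj⟩, rfl⟩
    simp only [coherentChain_apply]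
    cases j with
    | zero => exact Submodule.mem_sup_left (Submodule.subset_span ⟨i, by simp⟩)
    | succ j =>
      refine Submodule.mem_sup_right ?_
      rw [pow_succ', Module.End.mul_apply]
      exact LinearMap.mem_range_self _ _
  have h1 := Submodule.finrank_add_le_finrank_add_finrank (Submodule.span 𝕜 (Set.range D.head))
    (LinearMap.range (Matrix.toEuclideanLin D.A))
  rw [htop, finrank_top] at h1
  have h2 := LinearMap.finrank_range_add_finrank_ker (Matrix.toEuclideanLin D.A)
  have h3 := finrank_range_le_card (R := 𝕜) D.head
  rw [Set.finrank, Fintype.card_fin] at h3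
  omega

/-- Every `A ∈ 𝒱_R` is nilpotent, so its Jordan form is a coherent decomposition. -/
theorem IsLinorder.nonempty_coherentDecomposition (hR : IsLinorder R)
    {A : Matrix (Fin n) (Fin n) 𝕜} (hA : A ∈ matrixSpan R) :
    Nonempty (CoherentDecomposition (matrixSpan R)
      (Module.finrank 𝕜 (LinearMap.ker (Matrix.toEuclideanLin A)))) := by
  obtain ⟨ι, _, head, len, hcard, hlen, hli, hspan⟩ :=
    exists_chain_basis_of_isNilpotent _ _ (hR.isNilpotent_toEuclideanLin hA) rfl
  let e : Fin (Module.finrank 𝕜 (LinearMap.ker (Matrix.toEuclideanLin A))) ≃ ι :=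
    (Fintype.equivFinOfCardEq hcard).symm
  let e' : ((i : Fin _) × Fin (len (e i))) ≃ ((i : ι) × Fin (len i)) :=
    Equiv.sigmaCongrLeft (β := fun i => Fin (len i)) e
  have heq : (fun p : (i : Fin _) × Fin (len (e i)) =>
      coherentChain A (head (e p.1)) (len (e p.1)) p.2) =
      (fun p : (i : ι) × Fin (len i) =>
        ((Matrix.toEuclideanLin A : Module.End 𝕜 _) ^ (p.2 : ℕ)) (head p.1)) ∘ e' := by
    funext p
    rw [coherentChain_apply]
    rfl
  exact ⟨{ A := A
           A_mem := hA
           head := head ∘ e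
           len := len ∘ e
           len_pos := fun i => (hlen _).1
           linearIndependent := by
             simp only [Function.comp_apply]
             rw [heq]
             exact hli.comp _ e'.injective
           span_eq_top := by
             simp only [Function.comp_apply]
             rw [heq, Set.range_comp, e'.range_eq_univ, Set.image_univ]
             exact hspan }⟩

theorem span_le_range_sum_rankOneMatrix {ι : Type*} [DecidableEq ι]
    (v w : ι → EuclideanSpace 𝕜 (Fin n)) (J : Finset ι) (hv : LinearIndepOn 𝕜 v (J : Set ι)) :
    Submodule.span 𝕜 (w '' J) ≤
      LinearMap.range (Matrix.toEuclideanLin (∑ i ∈ J, rankOneMatrix (w i) (v i))) := by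
  rw [Submodule.span_le]
  rintro _ ⟨j, hj, rfl⟩
  -- Some `x` is orthogonal to every `v i` with `i ≠ j` but not to `v j`; it is sent to a nonzero
  -- multiple of `w j`.
  set K := Submodule.span 𝕜 (v '' ((J : Set ι) \ {j})) with hK
  have hvj : v j ∉ Kᗮᗮ := by
    rw [Submodule.orthogonal_orthogonal]
    exact LinearIndepOn.notMem_span hv hj
  rw [Submodule.mem_orthogonal'] at hvj
  push Not at hvj
  obtain ⟨x, hx, hvx⟩ := hvj
  refine ⟨(inner 𝕜 (v j) x)⁻¹ • x, ?_⟩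
  rw [map_smul, map_sum, LinearMap.sum_apply, Finset.sum_eq_single_of_mem j hj,
    toEuclideanLin_rankOneMatrix, inv_smul_smul₀ hvx]
  intro i hi hij
  rw [toEuclideanLin_rankOneMatrix,
    (Submodule.mem_orthogonal _ _).1 hx _ (Submodule.subset_span ⟨i, ⟨hi, hij⟩, rfl⟩), zero_smul]

/-- The min-max step, valid for any relation `R`: some `A ∈ 𝒱_R` and some antichain `C` satisfy
`dim ker A ≤ dim C`. Matroid intersection for a finite family of pairs `(vᵢ, wᵢ)` whose matrices
span `𝒱_R` gives a set `J` on which both `v` and `w` are independent, and a partition `S ∪ Sᶜ` of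
the indices with `dim span v_S + dim span w_Sᶜ = |J|`. Then `A = ∑_{i ∈ J} wᵢ vᵢ*` has rank
at least `|J|`, and the common orthogonal complement `C` of `v_S` and `w_Sᶜ` is an antichain of
codimension at most `|J|`. -/
theorem exists_finrank_ker_le_finrank_antichain
    (R : Set (EuclideanSpace 𝕜 (Fin n) × EuclideanSpace 𝕜 (Fin n))) :
    ∃ A ∈ matrixSpan R, ∃ C : Submodule 𝕜 (EuclideanSpace 𝕜 (Fin n)), IsAntichainFor R C ∧
      Module.finrank 𝕜 (LinearMap.ker (Matrix.toEuclideanLin A)) ≤ Module.finrank 𝕜 C := by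
  classical
  obtain ⟨N, f, hf, hspan⟩ : ∃ (N : ℕ) (f : Fin N → Matrix (Fin n) (Fin n) 𝕜),
      (∀ i, ∃ v w, (v, w) ∈ R ∧ f i = rankOneMatrix w v) ∧
      Submodule.span 𝕜 (Set.range f) = matrixSpan R := by
    obtain ⟨f, hf, hspan, -⟩ := Submodule.exists_fun_fin_finrank_span_eq 𝕜
      {M : Matrix (Fin n) (Fin n) 𝕜 | ∃ v w, (v, w) ∈ R ∧ M = rankOneMatrix w v}
    exact ⟨_, f, hf, hspan⟩
  choose v w hvw hfvw using hf
  let r₁ : Finset (Fin N) → ℕ := fun S => Module.finrank 𝕜 (Submodule.span 𝕜 (v '' S))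
  let r₂ : Finset (Fin N) → ℕ := fun S => Module.finrank 𝕜 (Submodule.span 𝕜 (w '' S))
  have h₁ : r₁ ∅ = 0 := by simp [r₁]
  have h₂ : r₂ ∅ = 0 := by simp [r₂]
  obtain ⟨S, -, hS⟩ := Finset.exists_min_image Finset.univ
    (fun S : Finset (Fin N) => r₁ S + r₂ (Finset.univ \ S)) Finset.univ_nonempty
  set k := r₁ S + r₂ (Finset.univ \ S) with hk
  obtain ⟨J, -, hJ, hJ₁, hJ₂⟩ := exists_common_independent r₁ r₂
    (finrank_span_image_union_add_inter_le v) (finrank_span_image_union_add_inter_le w)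
    (finrank_span_image_insert_le v) (finrank_span_image_insert_le w)
    Finset.univ ∅ k (fun T _ => by
      have := hS T (Finset.mem_univ _)
      simp only [Finset.empty_union]
      omega)
  rw [Finset.empty_union, h₁, zero_add] at hJ₁
  rw [Finset.empty_union, h₂, zero_add] at hJ₂
  have hli : LinearIndepOn 𝕜 v (J : Set (Fin N)) := by
    refine linearIndependent_iff_card_eq_finrank_span.2 ?_
    rw [Set.finrank, ← Set.image_eq_range]
    simpa using hJ.trans hJ₁.symm
  refine ⟨∑ i ∈ J, rankOneMatrix (w i) (v i),
    Submodule.sum_mem _ fun i _ => rankOneMatrix_mem_matrixSpan (hvw i),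
    (Submodule.span 𝕜 (v '' S) ⊔ Submodule.span 𝕜 (w '' (Finset.univ \ S : Finset (Fin N))))ᗮ,
    ?_, ?_⟩
  · rw [isAntichainFor_iff_forall_mem_matrixSpan]
    intro A hA x hx y hy
    rw [← Submodule.inf_orthogonal] at hx hy
    rw [← hspan] at hA
    induction hA using Submodule.span_induction with
    | mem A h =>
      obtain ⟨i, rfl⟩ := h
      rw [hfvw, toEuclideanLin_rankOneMatrix, inner_smul_right]
      by_cases hi : i ∈ S
      · rw [(Submodule.mem_orthogonal _ _).1 hx.1 _ (Submodule.subset_span ⟨i, hi, rfl⟩), zero_mul]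
      · rw [(Submodule.mem_orthogonal' _ _).1 hy.2 _
          (Submodule.subset_span ⟨i, by simpa using hi, rfl⟩), mul_zero]
    | zero => simp
    | add A B _ _ h₁ h₂ => rw [map_add, LinearMap.add_apply, inner_add_right, h₁, h₂, add_zero]
    | smul a A _ h => rw [map_smul, LinearMap.smul_apply, inner_smul_right, h, mul_zero]
  · have h1 := Submodule.finrank_mono (span_le_range_sum_rankOneMatrix v w J hli)
    have h2 := LinearMap.finrank_range_add_finrank_ker
      (Matrix.toEuclideanLin (∑ i ∈ J, rankOneMatrix (w i) (v i)))
    have h3 := Submodule.finrank_add_finrank_orthogonal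
      (Submodule.span 𝕜 (v '' S) ⊔ Submodule.span 𝕜 (w '' (Finset.univ \ S : Finset (Fin N))))
    have h4 := Submodule.finrank_add_le_finrank_add_finrank (Submodule.span 𝕜 (v '' S))
      (Submodule.span 𝕜 (w '' (Finset.univ \ S : Finset (Fin N))))
    simp only [r₁, r₂] at hk hJ₂
    omega

end

theorem theorem1p14 {𝕜 : Type*} [RCLike 𝕜] (n : ℕ) (hn : 1 ≤ n)
    (R : Set (EuclideanSpace 𝕜 (Fin n) × EuclideanSpace 𝕜 (Fin n))) (hR : IsLinorder R) :
    ∃ d : ℕ,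
      IsLeast {c : ℕ | Nonempty (CoherentDecomposition (matrixSpan R) c)} d ∧
      IsGreatest {k : ℕ | ∃ C : Submodule 𝕜 (EuclideanSpace 𝕜 (Fin n)),
        IsAntichainFor R C ∧ Module.finrank 𝕜 C = k} d := by
  obtain ⟨A, hA, C, hC, hle⟩ := exists_finrank_ker_le_finrank_antichain R
  have heq := le_antisymm hle (hR.finrank_antichain_le_finrank_ker hC hA)
  refine ⟨Module.finrank 𝕜 C, ⟨heq ▸ hR.nonempty_coherentDecomposition hA, ?_⟩, ⟨C, hC, rfl⟩, ?_⟩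
  · rintro c ⟨D⟩
    exact (hR.finrank_antichain_le_finrank_ker hC D.A_mem).trans D.finrank_ker_le
  · rintro _ ⟨C', hC', rfl⟩
    exact (hR.finrank_antichain_le_finrank_ker hC' hA).trans hle
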